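/- Let $\lambda\in(0,1/2)$, let $q_1=(\frac12,\frac{\sqrt3}2)$, $q_2=(0,0)$, $q_3=(1,0)$, and let $F_1,\dots,F_4:\mathbb R^2\to\mathbb R^2$ be $$F_i(x)=\tfrac12(x+q_i)\quad(i=1,2,3),$$ $$F_4(x_1,x_2)=\Big(\tfrac14\big(x_1-\sqrt3(1-4\lambda)x_2\big)+\tfrac{1-\lambda}2,\ \tfrac14\big(\sqrt3(1-4\lambda)x_1+x_2\big)+\tfrac{\sqrt3}2\lambda\Big).$$ Let the rotated triangle $K=K_\lambda$ be the unique non-empty compact set with $K=\bigcup_{i=1}^4F_i(K)$, equipped with the Euclidean distance; let $\bar R$ be its diameter. Let $p_1,\dots,p_4>0$ with $\sum_{i=1}^4p_i=1$, and let $\mu$ be a self-similar measure on $K$ with weights $(p_1,\dots,p_4)$, that is, a Borel probability measure on $K$ with $\mu=\sum_{i=1}^4p_i\,\mu\circ F_i^{-1}$. Write $V(x,r)=\mu(\{y\in K:|x-y|<r\})$. Then the following two properties hold together if and only if $p_1=p_2=p_3$: (VD) there is a constant $C\ge1$ such that $V(x,2r)\le C\,V(x,r)$ for all $x\in K$ and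 all $r>0$; (RVD) there are constants $C,\alpha>0$ such that $\dfrac{V(x,R)}{V(x,r)}\ge C^{-1}\Big(\dfrac Rr\Big)^{\alpha}$ for all $x\in K$ and all $0<r\le R<\bar R$. -/

import Mathlib

open Set MeasureTheory
open scoped NNReal ENNReal

namespace RotatedTriangle

/-! ### Volume doubling and reverse volume doubling on a metric measure space -/

/-- `(VD)`: there is `C ≥ 1` with `V(x, 2r) ≤ C V(x, r)` for all `x ∈ M` and `r > 0`, where
`V(x, r) = μ (B(x, r))` is the volume of the open ball of the metric space `M`. -/
def VolumeDoubling {M : Type*} [MetricSpace M] [MeasurableSpace M] (μ : Measure M) : Prop :=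
  ∃ C : ℝ, 1 ≤ C ∧ ∀ (x : M) (r : ℝ), 0 < r →
    μ (Metric.ball x (2 * r)) ≤ ENNReal.ofReal C * μ (Metric.ball x r)

/-- `(RVD)`: there are `C, α > 0` with `V(x, R) / V(x, r) ≥ C⁻¹ (R / r) ^ α` for all `x ∈ M` and
`0 < r ≤ R < diam M` (here `diam M` is an extended number, and the quotient is cleared). -/
def ReverseVolumeDoubling {M : Type*} [MetricSpace M] [MeasurableSpace M] (μ : Measure M) : Prop :=
  ∃ C α : ℝ, 0 < C ∧ 0 < α ∧ ∀ (x : M) (r R : ℝ), 0 < r → r ≤ R →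
    ENNReal.ofReal R < Metric.ediam (univ : Set M) →
    ENNReal.ofReal (C⁻¹ * (R / r) ^ α) * μ (Metric.ball x r) ≤ μ (Metric.ball x R)

/-! ### Self-similar sets and measures -/

/-- `K` is a non-empty compact set with `K = ⋃ i, F i (K)`. -/
structure IsSelfSimilarSet {ι X : Type*} [TopologicalSpace X] (F : ι → X → X) (K : Set X) :
    Prop where
  nonempty : K.Nonempty
  isCompact : IsCompact K
  eq_iUnion : K = ⋃ i, F i '' K

/-- Finitely many contractions of a complete metric space have exactly one self-similar set. -/
theorem existsUnique_isSelfSimilarSet {ι X : Type*} [Finite ι] [Nonempty ι] [MetricSpace X]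
    [CompleteSpace X] [Nonempty X] (F : ι → X → X) (k : ℝ≥0) (hk : k < 1)
    (hF : ∀ i, LipschitzWith k (F i)) : ∃! K : Set X, IsSelfSimilarSet F K := by
  have hcompact (K : TopologicalSpace.NonemptyCompacts X) : IsCompact (⋃ i, F i '' (K : Set X)) :=
    isCompact_iUnion fun i => K.isCompact.image (hF i).continuous
  have hne (K : TopologicalSpace.NonemptyCompacts X) : (⋃ i, F i '' (K : Set X)).Nonempty :=
    nonempty_iUnion.2 ⟨Classical.arbitrary ι, K.nonempty.image _⟩
  let Φ : TopologicalSpace.NonemptyCompacts X → TopologicalSpace.NonemptyCompacts X :=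
    fun K => ⟨⟨⋃ i, F i '' (K : Set X), hcompact K⟩, hne K⟩
  have himg (i : ι) (s t : TopologicalSpace.NonemptyCompacts X) (x : X) (hx : x ∈ (s : Set X)) :
      ∃ y ∈ (t : Set X), edist (F i x) (F i y) ≤ k * edist s t := by
    obtain ⟨y, hy, hxy⟩ := t.isCompact.exists_infEDist_eq_edist t.nonempty x
    refine ⟨y, hy, (hF i x y).trans ?_⟩
    rw [← hxy]
    exact mul_le_mul_right (Metric.infEDist_le_hausdorffEDist_of_mem hx) _
  have hΦ : ContractingWith k Φ := by
    refine ⟨hk, fun s t => Metric.hausdorffEDist_le_of_mem_edist ?_ ?_⟩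
    · intro z hz
      obtain ⟨i, x, hx, rfl⟩ := mem_iUnion.1 hz
      obtain ⟨y, hy, h⟩ := himg i s t x hx
      exact ⟨F i y, mem_iUnion.2 ⟨i, mem_image_of_mem _ hy⟩, h⟩
    · intro z hz
      obtain ⟨i, x, hx, rfl⟩ := mem_iUnion.1 hz
      obtain ⟨y, hy, h⟩ := himg i t s x hx
      exact ⟨F i y, mem_iUnion.2 ⟨i, mem_image_of_mem _ hy⟩, edist_comm s t ▸ h⟩
  have : Nonempty (TopologicalSpace.NonemptyCompacts X) := ⟨{Classical.arbitrary X}⟩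
  obtain ⟨Q, hQ⟩ : ∃ Q : TopologicalSpace.NonemptyCompacts X, Q = hΦ.fixedPoint Φ := ⟨_, rfl⟩
  have hfix : Φ Q = Q := hQ ▸ hΦ.fixedPoint_isFixedPt
  refine ⟨Q, ⟨Q.nonempty, Q.isCompact, ?_⟩, ?_⟩
  · exact congrArg (fun K : TopologicalSpace.NonemptyCompacts X => (K : Set X)) hfix.symm
  · intro L hL
    have h : Φ ⟨⟨L, hL.isCompact⟩, hL.nonempty⟩ = ⟨⟨L, hL.isCompact⟩, hL.nonempty⟩ :=
      SetLike.coe_injective hL.eq_iUnion.symm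
    exact congrArg (fun K : TopologicalSpace.NonemptyCompacts X => (K : Set X))
      ((hΦ.fixedPoint_unique h).trans hQ.symm)

/-- `μ` is a self-similar measure for the maps `F i : X → X` with weights `p i`: a probability
measure with `μ = ∑ i, p i • (μ ∘ (F i)⁻¹)`. -/
def IsSelfSimilarMeasure {ι X : Type*} [Fintype ι] [MeasurableSpace X] (F : ι → X → X)
    (p : ι → ℝ) (μ : Measure X) : Prop :=
  IsProbabilityMeasure μ ∧ μ = ∑ i, ENNReal.ofReal (p i) • μ.map (F i)

/-! ### The rotated triangle -/

/-- The four similitudes of the plane; the first three fix the vertices `(1/2, √3/2)`, `(0, 0)`,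
`(1, 0)` of the unit triangle, and the index `3` is the rotated map depending on `lam`. -/
noncomputable def rotatedMap (lam : ℝ) :
    Fin 4 → EuclideanSpace ℝ (Fin 2) → EuclideanSpace ℝ (Fin 2)
  | 0 => fun x => (1 / 2 : ℝ) • (x + !₂[1 / 2, √3 / 2])
  | 1 => fun x => (1 / 2 : ℝ) • (x + !₂[0, 0])
  | 2 => fun x => (1 / 2 : ℝ) • (x + !₂[1, 0])
  | 3 => fun x =>
      !₂[(1 / 4) * (x 0 - √3 * (1 - 4 * lam) * x 1) + (1 - lam) / 2,
        (1 / 4) * (√3 * (1 - 4 * lam) * x 0 + x 1) + √3 / 2 * lam]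

theorem lipschitzWith_rotatedMap {lam : ℝ} (hlam : lam ∈ Ioo (0 : ℝ) (1 / 2)) (i : Fin 4) :
    LipschitzWith (1 / 2) (rotatedMap lam i) := by
  refine LipschitzWith.of_dist_le_mul fun x y => ?_
  have hhalf (q : EuclideanSpace ℝ (Fin 2)) :
      dist ((1 / 2 : ℝ) • (x + q)) ((1 / 2 : ℝ) • (y + q)) ≤ ((1 / 2 : ℝ≥0) : ℝ) * dist x y := by
    rw [dist_smul₀, dist_add_right]
    norm_num
  fin_cases i
  · exact hhalf _
  · exact hhalf _
  · exact hhalf _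
  · have h3 : √3 * √3 = 3 := Real.mul_self_sqrt (by norm_num)
    have hl : lam * (1 - 2 * lam) ≥ 0 := mul_nonneg hlam.1.le (by linarith [hlam.2])
    simp only [rotatedMap, EuclideanSpace.dist_eq, Fin.sum_univ_two, Real.dist_eq, sq_abs]
    have h2 : ((1 / 2 : ℝ≥0) : ℝ) = √((1 / 2) ^ 2) := by
      rw [Real.sqrt_sq (by norm_num)]; norm_num
    rw [h2, ← Real.sqrt_mul (by norm_num)]
    refine Real.sqrt_le_sqrt ?_
    simp only [Fin.isValue, Matrix.cons_val_zero, Matrix.cons_val_one]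
    have key : ((1 / 4) * (x 0 - √3 * (1 - 4 * lam) * x 1) + (1 - lam) / 2 -
          ((1 / 4) * (y 0 - √3 * (1 - 4 * lam) * y 1) + (1 - lam) / 2)) ^ 2 +
        ((1 / 4) * (√3 * (1 - 4 * lam) * x 0 + x 1) + √3 / 2 * lam -
          ((1 / 4) * (√3 * (1 - 4 * lam) * y 0 + y 1) + √3 / 2 * lam)) ^ 2 =
        ((1 / 2) ^ 2 - (3 / 2) * (lam * (1 - 2 * lam))) *
          ((x 0 - y 0) ^ 2 + (x 1 - y 1) ^ 2) := by
      linear_combination ((1 - 4 * lam) ^ 2 / 16 * ((x 0 - y 0) ^ 2 + (x 1 - y 1) ^ 2)) * h3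
    refine key.trans_le (mul_le_mul_of_nonneg_right (by linarith) (by positivity))

theorem existsUnique_rotatedTriangle {lam : ℝ} (hlam : lam ∈ Ioo (0 : ℝ) (1 / 2)) :
    ∃! K : Set (EuclideanSpace ℝ (Fin 2)), IsSelfSimilarSet (rotatedMap lam) K :=
  existsUnique_isSelfSimilarSet _ (1 / 2) (by norm_num) (lipschitzWith_rotatedMap hlam)

/-- The rotated triangle `K_lam`: the unique self-similar set of the four maps. -/
noncomputable def rotatedTriangle {lam : ℝ} (hlam : lam ∈ Ioo (0 : ℝ) (1 / 2)) :
    Set (EuclideanSpace ℝ (Fin 2)) :=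
  (existsUnique_rotatedTriangle hlam).choose

theorem isSelfSimilarSet_rotatedTriangle {lam : ℝ} (hlam : lam ∈ Ioo (0 : ℝ) (1 / 2)) :
    IsSelfSimilarSet (rotatedMap lam) (rotatedTriangle hlam) :=
  (existsUnique_rotatedTriangle hlam).choose_spec.1

theorem mapsTo_rotatedMap {lam : ℝ} (hlam : lam ∈ Ioo (0 : ℝ) (1 / 2)) (i : Fin 4) :
    MapsTo (rotatedMap lam i) (rotatedTriangle hlam) (rotatedTriangle hlam) := by
  intro x hx
  rw [(isSelfSimilarSet_rotatedTriangle hlam).eq_iUnion]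
  exact mem_iUnion.2 ⟨i, mem_image_of_mem _ hx⟩

/-- The four maps as maps of `K_lam` into itself. -/
noncomputable def rotatedSelfMap {lam : ℝ} (hlam : lam ∈ Ioo (0 : ℝ) (1 / 2)) (i : Fin 4) :
    rotatedTriangle hlam → rotatedTriangle hlam :=
  (mapsTo_rotatedMap hlam i).restrict

end RotatedTriangle

/-! A word `w` in the four maps gives a cell of size comparable to its contraction ratio `r_w` and
of mass at least the product `p_w` of its weights. Both properties reduce to a converse: a ball of
radius `c * r_w` about a point of the cell has mass at most a constant times `p_w`, which is
`measureReal_ball_wordMap_le`. Small balls and large balls are then compared through subcells.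

The converse can fail only where different cells come close. Barycentric coordinates locate these
places: a point whose image under one map is near another cell must itself be near a side of the
triangle (`exists_gap_mul_coord_le`). A cell whose word uses the rotated map keeps a distance of
order `r_w` from the sides (`gap_mul_le_coord_wordMap`). So only words in the three corner maps
matter. If these maps have a common weight `q`, every such cell of level `n` has size of order `2⁻ⁿ`
and weight `qⁿ`, whatever its letters, and sets of size `2⁻ⁿ` near a side have mass at most `2 * qⁿ`
(`measureReal_sideSet_le`).

Conversely, the cells of the words `i jⁿ` and `j iⁿ` share the midpoint of a side and have the same
size, while their weights are `p_i * p_jⁿ` and `p_j * p_iⁿ`. Volume doubling bounds the quotient of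
these uniformly in `n`, which forces `p_i = p_j` (`weight_le_of_volumeDoubling`). Reverse volume
doubling is not needed for this direction. -/

namespace RotatedTriangle

/-! ### Barycentric coordinates -/

/-- The barycentric coordinates of the plane with respect to the vertices of the unit triangle. -/
noncomputable def bary : Fin 3 → EuclideanSpace ℝ (Fin 2) → ℝ
  | 0 => fun x => 2 * x 1 / √3
  | 1 => fun x => 1 - x 0 - x 1 / √3
  | 2 => fun x => x 0 - x 1 / √3

theorem sum_bary (x : EuclideanSpace ℝ (Fin 2)) : bary 0 x + bary 1 x + bary 2 x = 1 := by
  simp only [bary]; ring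

theorem sum_bary_cyclic (k : Fin 3) (x : EuclideanSpace ℝ (Fin 2)) :
    bary k x + bary (k + 1) x + bary (k + 2) x = 1 := by
  have h := sum_bary x
  fin_cases k
  · exact h
  · change bary 1 x + bary 2 x + bary 0 x = 1
    linarith
  · change bary 2 x + bary 0 x + bary 1 x = 1
    linarith

@[fun_prop]
theorem continuous_bary (k : Fin 3) : Continuous (bary k) := by
  fin_cases k <;> simp only [bary] <;> fun_prop

theorem abs_coord_sub_le_dist (x y : EuclideanSpace ℝ (Fin 2)) (k : Fin 2) :
    |x k - y k| ≤ dist x y := by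
  rw [dist_eq_norm]
  exact PiLp.norm_apply_le (x - y) k

theorem abs_bary_sub_le (k : Fin 3) (x y : EuclideanSpace ℝ (Fin 2)) :
    |bary k x - bary k y| ≤ 2 * dist x y := by
  have h0 := abs_coord_sub_le_dist x y 0
  have h1 := abs_coord_sub_le_dist x y 1
  have h3 : |(x 1 - y 1) / √3| ≤ dist x y := by
    rw [abs_div, abs_of_nonneg (Real.sqrt_nonneg 3)]
    refine (div_le_self (abs_nonneg _) ?_).trans h1
    exact Real.one_le_sqrt.2 (by norm_num)
  have e0 : bary 0 x - bary 0 y = 2 * ((x 1 - y 1) / √3) := by simp only [bary]; ring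
  have e1 : bary 1 x - bary 1 y = -(x 0 - y 0) - (x 1 - y 1) / √3 := by simp only [bary]; ring
  have e2 : bary 2 x - bary 2 y = (x 0 - y 0) - (x 1 - y 1) / √3 := by simp only [bary]; ring
  rw [abs_le] at h0 h3 ⊢
  fin_cases k
  · change -(2 * dist x y) ≤ bary 0 x - bary 0 y ∧ bary 0 x - bary 0 y ≤ _
    rw [e0]; constructor <;> linarith
  · change -(2 * dist x y) ≤ bary 1 x - bary 1 y ∧ bary 1 x - bary 1 y ≤ _
    rw [e1]; constructor <;> linarith
  · change -(2 * dist x y) ≤ bary 2 x - bary 2 y ∧ bary 2 x - bary 2 y ≤ _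
    rw [e2]; constructor <;> linarith

theorem dist_le_abs_bary_sub (x y : EuclideanSpace ℝ (Fin 2)) :
    dist x y ≤ 2 * (|bary 0 x - bary 0 y| + |bary 2 x - bary 2 y|) := by
  have h3 : √3 * √3 = 3 := Real.mul_self_sqrt (by norm_num)
  have h3' : √3 ≠ 0 := by positivity
  have e1 : x 1 - y 1 = √3 / 2 * (bary 0 x - bary 0 y) := by
    simp only [bary]; field_simp
  have e0 : x 0 - y 0 = (bary 0 x - bary 0 y) / 2 + (bary 2 x - bary 2 y) := by
    simp only [bary]; ring
  set a := bary 0 x - bary 0 y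
  set b := bary 2 x - bary 2 y
  rw [EuclideanSpace.dist_eq, Fin.sum_univ_two, Real.dist_eq, Real.dist_eq, sq_abs, sq_abs, e0, e1]
  refine Real.sqrt_le_iff.2 ⟨by positivity, ?_⟩
  have ha := sq_abs a
  have hb := sq_abs b
  have hab : a * b ≤ |a| * |b| := (le_abs_self _).trans_eq (abs_mul a b)
  have : 0 ≤ |a| * |b| := by positivity
  nlinarith [sq_nonneg a, sq_nonneg b]

theorem bary_rotatedMap_castSucc (lam : ℝ) (i k : Fin 3) (x : EuclideanSpace ℝ (Fin 2)) :
    bary k (rotatedMap lam i.castSucc x) = (bary k x + if k = i then 1 else 0) / 2 := by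
  have h3 : √3 ≠ 0 := by positivity
  fin_cases i <;> fin_cases k <;> simp [bary, rotatedMap] <;> field_simp <;> ring

theorem bary_rotatedMap_three (lam : ℝ) (k : Fin 3) (x : EuclideanSpace ℝ (Fin 2)) :
    bary k (rotatedMap lam 3 x) =
      bary k x / 2 + lam * bary (k + 1) x + (1 / 2 - lam) * bary (k + 2) x := by
  have h3 : √3 ≠ 0 := by positivity
  have h3' : √3 ^ 2 = 3 := Real.sq_sqrt (by norm_num)
  fin_cases k
  · change bary 0 _ = bary 0 x / 2 + lam * bary 1 x + (1 / 2 - lam) * bary 2 x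
    simp [bary, rotatedMap]; field_simp; ring_nf
  · change bary 1 _ = bary 1 x / 2 + lam * bary 2 x + (1 / 2 - lam) * bary 0 x
    simp [bary, rotatedMap]; field_simp; ring_nf; rw [h3']; ring
  · change bary 2 _ = bary 2 x / 2 + lam * bary 0 x + (1 / 2 - lam) * bary 1 x
    simp [bary, rotatedMap]; field_simp; ring_nf; rw [h3']; ring

/-! ### Contraction ratios -/

/-- The contraction ratios of the four similitudes. -/
noncomputable def ratio (lam : ℝ) : Fin 4 → ℝ :=
  ![1 / 2, 1 / 2, 1 / 2, √(1 / 4 - 3 / 2 * (lam * (1 - 2 * lam)))]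

theorem eq_three_or_castSucc (i : Fin 4) : i = 3 ∨ ∃ j : Fin 3, i = j.castSucc := by
  induction i using Fin.lastCases with
  | last => exact Or.inl rfl
  | cast j => exact Or.inr ⟨j, rfl⟩

theorem ratio_castSucc (lam : ℝ) (i : Fin 3) : ratio lam i.castSucc = 1 / 2 := by
  fin_cases i <;> rfl

/-- The product `lam * (1 - 2 * lam)` is at most `1 / 8`, with equality at `lam = 1 / 4`, where the
rotated map has ratio exactly `1 / 4`. -/
theorem quarter_le_ratio (lam : ℝ) (i : Fin 4) : 1 / 4 ≤ ratio lam i := by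
  obtain rfl | ⟨j, rfl⟩ := eq_three_or_castSucc i
  · exact Real.le_sqrt_of_sq_le (by nlinarith [sq_nonneg (lam - 1 / 4)])
  · rw [ratio_castSucc]; norm_num

theorem ratio_pos (lam : ℝ) (i : Fin 4) : 0 < ratio lam i :=
  lt_of_lt_of_le (by norm_num) (quarter_le_ratio lam i)

theorem ratio_le_half {lam : ℝ} (hlam : lam ∈ Ioo (0 : ℝ) (1 / 2)) (i : Fin 4) :
    ratio lam i ≤ 1 / 2 := by
  obtain rfl | ⟨j, rfl⟩ := eq_three_or_castSucc i
  · refine Real.sqrt_le_iff.2 ⟨by norm_num, ?_⟩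
    have : 0 ≤ lam * (1 - 2 * lam) := mul_nonneg hlam.1.le (by linarith [hlam.2])
    linarith
  · rw [ratio_castSucc]

theorem dist_rotatedMap (lam : ℝ) (i : Fin 4) (x y : EuclideanSpace ℝ (Fin 2)) :
    dist (rotatedMap lam i x) (rotatedMap lam i y) = ratio lam i * dist x y := by
  have hhalf (q : EuclideanSpace ℝ (Fin 2)) :
      dist ((1 / 2 : ℝ) • (x + q)) ((1 / 2 : ℝ) • (y + q)) = 1 / 2 * dist x y := by
    rw [dist_smul₀, dist_add_right]
    norm_num
  fin_cases i
  · exact hhalf _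
  · exact hhalf _
  · exact hhalf _
  · have h3 : √3 * √3 = 3 := Real.mul_self_sqrt (by norm_num)
    change _ = √(1 / 4 - 3 / 2 * (lam * (1 - 2 * lam))) * dist x y
    simp only [rotatedMap, EuclideanSpace.dist_eq, Fin.sum_univ_two, Real.dist_eq, sq_abs]
    rw [← Real.sqrt_mul (by nlinarith [sq_nonneg (lam - 1 / 4)])]
    congr 1
    simp only [Fin.isValue, Matrix.cons_val_zero, Matrix.cons_val_one]
    linear_combination ((1 - 4 * lam) ^ 2 / 16 * ((x 0 - y 0) ^ 2 + (x 1 - y 1) ^ 2)) * h3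

/-- The distance from the rotated cell to the sides of the triangle, in barycentric terms. -/
noncomputable def gap (lam : ℝ) : ℝ := min lam (1 / 2 - lam)

theorem gap_pos {lam : ℝ} (hlam : lam ∈ Ioo (0 : ℝ) (1 / 2)) : 0 < gap lam :=
  lt_min hlam.1 (by linarith [hlam.2])

theorem gap_le_quarter (lam : ℝ) : gap lam ≤ 1 / 4 := by
  have h1 : gap lam ≤ lam := min_le_left _ _
  have h2 : gap lam ≤ 1 / 2 - lam := min_le_right _ _
  linarith

/-! ### The rotated triangle lies in the unit triangle -/

variable {lam : ℝ} (hlam : lam ∈ Ioo (0 : ℝ) (1 / 2))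

theorem exists_rotatedSelfMap_eq (x : rotatedTriangle hlam) :
    ∃ (i : Fin 4) (y : rotatedTriangle hlam), rotatedSelfMap hlam i y = x := by
  have hx := (isSelfSimilarSet_rotatedTriangle hlam).eq_iUnion.subset x.2
  obtain ⟨i, y, hy, h⟩ := mem_iUnion.1 hx
  exact ⟨i, ⟨y, hy⟩, Subtype.ext h⟩

/-- Minimum principle: let `t < 0` be the least value of all three coordinates on the compact set. A
corner map only gives values at least `t / 2 > t`. The rotated map averages the coordinates with
weights at least `gap lam`, so its values exceed `t` by at least `gap lam * (1 - 3 * t) > 0`. Hence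
`t` is not attained. -/
theorem bary_nonneg_of_mem {x : EuclideanSpace ℝ (Fin 2)} (hx : x ∈ rotatedTriangle hlam)
    (k : Fin 3) : 0 ≤ bary k x := by
  have hK := isSelfSimilarSet_rotatedTriangle hlam
  choose m hmK hm using fun k : Fin 3 =>
    hK.isCompact.exists_isMinOn hK.nonempty (continuous_bary k).continuousOn
  obtain ⟨k₀, hk₀⟩ := Finite.exists_min fun k => bary k (m k)
  have hmin (l : Fin 3) (z : EuclideanSpace ℝ (Fin 2)) (hz : z ∈ rotatedTriangle hlam) :
      bary k₀ (m k₀) ≤ bary l z := (hk₀ l).trans (hm l hz)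
  suffices h : 0 ≤ bary k₀ (m k₀) from h.trans (hmin k x hx)
  by_contra! hneg
  have hmem := hmK k₀
  rw [hK.eq_iUnion] at hmem
  obtain ⟨i, y, hy, h⟩ := mem_iUnion.1 hmem
  obtain rfl | ⟨j, rfl⟩ := eq_three_or_castSucc i
  · have e := bary_rotatedMap_three lam k₀ y
    rw [h] at e
    have hs := sum_bary_cyclic k₀ y
    have h0 := hmin k₀ y hy
    have h1 := hmin (k₀ + 1) y hy
    have h2 := hmin (k₀ + 2) y hy
    set t := bary k₀ (m k₀)
    have hg := gap_pos hlam
    have hg1 : gap lam ≤ lam := min_le_left _ _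
    have hg2 : gap lam ≤ 1 / 2 - lam := min_le_right _ _
    nlinarith [mul_nonneg (sub_nonneg.2 hg1) (sub_nonneg.2 h1),
      mul_nonneg (sub_nonneg.2 hg2) (sub_nonneg.2 h2),
      mul_nonneg (sub_nonneg.2 (gap_le_quarter lam)) (sub_nonneg.2 h0)]
  · have e := bary_rotatedMap_castSucc lam j k₀ y
    rw [h] at e
    have h0 := hmin k₀ y hy
    split_ifs at e <;> linarith

/-! ### Coordinates on the rotated triangle -/

/-- The barycentric coordinates on the rotated triangle. -/
noncomputable def coord (k : Fin 3) (x : rotatedTriangle hlam) : ℝ := bary k x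

theorem continuous_coord (k : Fin 3) : Continuous (coord hlam k) :=
  (continuous_bary k).comp continuous_subtype_val

variable {hlam}

theorem coord_nonneg (k : Fin 3) (x : rotatedTriangle hlam) : 0 ≤ coord hlam k x :=
  bary_nonneg_of_mem hlam x.2 k

theorem sum_coord (k : Fin 3) (x : rotatedTriangle hlam) :
    coord hlam k x + coord hlam (k + 1) x + coord hlam (k + 2) x = 1 :=
  sum_bary_cyclic k x

theorem coord_le_one (k : Fin 3) (x : rotatedTriangle hlam) : coord hlam k x ≤ 1 := by
  linarith [sum_coord k x, coord_nonneg (k + 1) x, coord_nonneg (k + 2) x]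

theorem abs_coord_sub_le (k : Fin 3) (x y : rotatedTriangle hlam) :
    |coord hlam k x - coord hlam k y| ≤ 2 * dist x y :=
  abs_bary_sub_le k x y

theorem dist_le_abs_coord_sub (x y : rotatedTriangle hlam) :
    dist x y ≤ 2 * (|coord hlam 0 x - coord hlam 0 y| + |coord hlam 2 x - coord hlam 2 y|) :=
  dist_le_abs_bary_sub x y

theorem dist_le_four (x y : rotatedTriangle hlam) : dist x y ≤ 4 := by
  have h := dist_le_abs_coord_sub x y
  have hk (k : Fin 3) : |coord hlam k x - coord hlam k y| ≤ 1 := by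
    rw [abs_le]
    constructor <;> linarith [coord_nonneg k x, coord_nonneg k y, coord_le_one k x,
      coord_le_one k y]
  linarith [hk 0, hk 2]

theorem coord_castSucc (i k : Fin 3) (x : rotatedTriangle hlam) :
    coord hlam k (rotatedSelfMap hlam i.castSucc x) =
      (coord hlam k x + if k = i then 1 else 0) / 2 :=
  bary_rotatedMap_castSucc lam i k x

theorem coord_castSucc_self (i : Fin 3) (x : rotatedTriangle hlam) :
    coord hlam i (rotatedSelfMap hlam i.castSucc x) = (coord hlam i x + 1) / 2 := by
  rw [coord_castSucc, if_pos rfl]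

theorem coord_castSucc_ne {i k : Fin 3} (h : k ≠ i) (x : rotatedTriangle hlam) :
    coord hlam k (rotatedSelfMap hlam i.castSucc x) = coord hlam k x / 2 := by
  rw [coord_castSucc, if_neg h, add_zero]

theorem half_coord_le (i k : Fin 3) (x : rotatedTriangle hlam) :
    coord hlam k x / 2 ≤ coord hlam k (rotatedSelfMap hlam i.castSucc x) := by
  rw [coord_castSucc]
  split_ifs <;> linarith

theorem coord_three (k : Fin 3) (x : rotatedTriangle hlam) :
    coord hlam k (rotatedSelfMap hlam 3 x) = coord hlam k x / 2 + lam * coord hlam (k + 1) x +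
      (1 / 2 - lam) * coord hlam (k + 2) x :=
  bary_rotatedMap_three lam k x

theorem gap_le_coord_three (k : Fin 3) (x : rotatedTriangle hlam) :
    gap lam ≤ coord hlam k (rotatedSelfMap hlam 3 x) := by
  rw [coord_three]
  have hg1 : gap lam ≤ lam := min_le_left _ _
  have hg2 : gap lam ≤ 1 / 2 - lam := min_le_right _ _
  have h0 := coord_nonneg k x
  have h1 := coord_nonneg (k + 1) x
  have h2 := coord_nonneg (k + 2) x
  have hs := sum_coord k x
  nlinarith [mul_nonneg (sub_nonneg.2 hg1) h1, mul_nonneg (sub_nonneg.2 hg2) h2,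
    mul_nonneg (sub_nonneg.2 (gap_le_quarter lam)) h0]

theorem coord_three_le (k : Fin 3) (x : rotatedTriangle hlam) :
    coord hlam k (rotatedSelfMap hlam 3 x) ≤ 1 / 2 - gap lam * (1 - coord hlam k x) := by
  rw [coord_three]
  have hg1 : gap lam ≤ lam := min_le_left _ _
  have hg2 : gap lam ≤ 1 / 2 - lam := min_le_right _ _
  have h1 := coord_nonneg (k + 1) x
  have h2 := coord_nonneg (k + 2) x
  have hs : coord hlam k x = 1 - coord hlam (k + 1) x - coord hlam (k + 2) x := by
    linarith [sum_coord k x]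
  rw [hs]
  nlinarith [mul_nonneg (sub_nonneg.2 hg1) h2, mul_nonneg (sub_nonneg.2 hg2) h1]

theorem coord_three_le_half (k : Fin 3) (x : rotatedTriangle hlam) :
    coord hlam k (rotatedSelfMap hlam 3 x) ≤ 1 / 2 := by
  have := mul_nonneg (gap_pos hlam).le (sub_nonneg.2 (coord_le_one k x))
  linarith [coord_three_le k x]

/-- The vertex coordinate `i` is at most `1 / 2` on every cell but the `i`-th one. -/
theorem coord_le_half {k : Fin 3} {i : Fin 4} (h : i ≠ k.castSucc) (x : rotatedTriangle hlam) :
    coord hlam k (rotatedSelfMap hlam i x) ≤ 1 / 2 := by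
  obtain rfl | ⟨j, rfl⟩ := eq_three_or_castSucc i
  · exact coord_three_le_half k x
  · have hkj : k ≠ j := fun e => h (by rw [e])
    rw [coord_castSucc_ne hkj]
    linarith [coord_le_one k x]

theorem dist_rotatedSelfMap (i : Fin 4) (x y : rotatedTriangle hlam) :
    dist (rotatedSelfMap hlam i x) (rotatedSelfMap hlam i y) = ratio lam i * dist x y :=
  dist_rotatedMap lam i x y

theorem continuous_rotatedSelfMap (i : Fin 4) : Continuous (rotatedSelfMap hlam i) :=
  (LipschitzWith.of_dist_le_mul (K := ⟨ratio lam i, (ratio_pos lam i).le⟩) fun x y =>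
    (dist_rotatedSelfMap i x y).le).continuous

/-- A point of a cell that is close to another cell comes from a point close to a side. -/
theorem exists_gap_mul_coord_le {i j : Fin 4} (hij : i ≠ j) (x y : rotatedTriangle hlam) :
    ∃ k, gap lam * coord hlam k x ≤
      2 * dist (rotatedSelfMap hlam i x) (rotatedSelfMap hlam j y) := by
  set d := dist (rotatedSelfMap hlam i x) (rotatedSelfMap hlam j y) with hd
  have hdist (k : Fin 3) := (abs_le.1 (abs_coord_sub_le k (rotatedSelfMap hlam i x)
    (rotatedSelfMap hlam j y)))
  have hg := gap_pos hlam
  obtain rfl | ⟨l, rfl⟩ := eq_three_or_castSucc i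
  · obtain rfl | ⟨l, rfl⟩ := eq_three_or_castSucc j
    · exact absurd rfl hij
    -- The corner cell has `l`-th coordinate at least `1 / 2`, and the rotated cell reaches this
    -- value only at the image of the `l`-th vertex. So `x` is near that vertex and hence near both
    -- sides through it; `l + 1` picks one of them.
    refine ⟨l + 1, ?_⟩
    have h1 := coord_three_le l x
    have h2 := coord_castSucc_self l y
    have h3 := (hdist l).1
    have h4 := coord_nonneg l y
    have h5 : coord hlam (l + 1) x ≤ 1 - coord hlam l x := by
      linarith [sum_coord l x, coord_nonneg (l + 2) x]
    have h6 := mul_le_mul_of_nonneg_left h5 hg.le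
    linarith
  · refine ⟨l, ?_⟩
    have h1 := coord_castSucc_self l x
    have h2 := coord_le_half hij.symm y
    have h3 := (hdist l).2
    have h4 := coord_nonneg l x
    nlinarith [gap_le_quarter lam]

end RotatedTriangle

namespace RotatedTriangle

variable {lam : ℝ} {hlam : lam ∈ Ioo (0 : ℝ) (1 / 2)}

/-! ### Words -/

variable (hlam) in
/-- The composition of the maps along a word. -/
noncomputable def wordMap (w : List (Fin 4)) (x : rotatedTriangle hlam) : rotatedTriangle hlam :=
  w.foldr (rotatedSelfMap hlam) x

/-- The product of the numbers `a i` along a word. -/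
def wordProd (a : Fin 4 → ℝ) (w : List (Fin 4)) : ℝ := (w.map a).prod

@[simp] theorem wordMap_nil (x : rotatedTriangle hlam) : wordMap hlam [] x = x := rfl

@[simp] theorem wordMap_cons (i : Fin 4) (w : List (Fin 4)) (x : rotatedTriangle hlam) :
    wordMap hlam (i :: w) x = rotatedSelfMap hlam i (wordMap hlam w x) := rfl

@[simp] theorem wordMap_append (v w : List (Fin 4)) (x : rotatedTriangle hlam) :
    wordMap hlam (v ++ w) x = wordMap hlam v (wordMap hlam w x) := by
  simp [wordMap]

@[simp] theorem wordProd_nil (a : Fin 4 → ℝ) : wordProd a [] = 1 := rfl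

@[simp] theorem wordProd_cons (a : Fin 4 → ℝ) (i : Fin 4) (w : List (Fin 4)) :
    wordProd a (i :: w) = a i * wordProd a w := by
  simp [wordProd]

@[simp] theorem wordProd_append (a : Fin 4 → ℝ) (v w : List (Fin 4)) :
    wordProd a (v ++ w) = wordProd a v * wordProd a w := by
  simp [wordProd]

theorem wordProd_pos {a : Fin 4 → ℝ} (ha : ∀ i, 0 < a i) (w : List (Fin 4)) :
    0 < wordProd a w := by
  induction w with
  | nil => simp
  | cons i w ih => rw [wordProd_cons]; exact mul_pos (ha i) ih

theorem wordProd_le_one {a : Fin 4 → ℝ} (ha : ∀ i, 0 < a i) (ha1 : ∀ i, a i ≤ 1)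
    (w : List (Fin 4)) : wordProd a w ≤ 1 := by
  induction w with
  | nil => simp
  | cons i w ih => rw [wordProd_cons]; exact mul_le_one₀ (ha1 i) (wordProd_pos ha w).le ih

theorem wordProd_eq_pow {a : Fin 4 → ℝ} {q : ℝ} (ha : ∀ i : Fin 3, a i.castSucc = q)
    {w : List (Fin 4)} (hw : 3 ∉ w) : wordProd a w = q ^ w.length := by
  induction w with
  | nil => simp
  | cons i w ih =>
    rw [List.mem_cons, not_or] at hw
    obtain rfl | ⟨j, rfl⟩ := eq_three_or_castSucc i
    · exact absurd rfl hw.1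
    · rw [wordProd_cons, ih hw.2, ha, List.length_cons, pow_succ']

theorem wordProd_rpow_le {a b : Fin 4 → ℝ} {t : ℝ} (ha : ∀ i, 0 < a i) (hb : ∀ i, 0 < b i)
    (h : ∀ i, a i ≤ b i ^ t) (w : List (Fin 4)) : wordProd a w ≤ wordProd b w ^ t := by
  induction w with
  | nil => simp
  | cons i w ih =>
    rw [wordProd_cons, wordProd_cons, Real.mul_rpow (hb i).le (wordProd_pos hb w).le]
    exact mul_le_mul (h i) ih (wordProd_pos ha w).le (Real.rpow_nonneg (hb i).le _)

theorem le_wordProd_pow {a b : Fin 4 → ℝ} {n : ℕ} (ha : ∀ i, 0 < a i) (hb : ∀ i, 0 < b i)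
    (h : ∀ i, b i ^ n ≤ a i) (w : List (Fin 4)) : wordProd b w ^ n ≤ wordProd a w := by
  induction w with
  | nil => simp
  | cons i w ih =>
    rw [wordProd_cons, wordProd_cons, mul_pow]
    exact mul_le_mul (h i) ih (pow_pos (wordProd_pos hb w) n).le (ha i).le

variable (lam) in
theorem wordProd_ratio_pos (w : List (Fin 4)) : 0 < wordProd (ratio lam) w :=
  wordProd_pos (ratio_pos lam) w

theorem wordProd_ratio_le_one {lam : ℝ} (hlam : lam ∈ Ioo (0 : ℝ) (1 / 2)) (w : List (Fin 4)) :
    wordProd (ratio lam) w ≤ 1 :=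
  wordProd_le_one (ratio_pos lam) (fun i => (ratio_le_half hlam i).trans (by norm_num)) w

theorem dist_wordMap (w : List (Fin 4)) (x y : rotatedTriangle hlam) :
    dist (wordMap hlam w x) (wordMap hlam w y) = wordProd (ratio lam) w * dist x y := by
  induction w with
  | nil => simp
  | cons i w ih => rw [wordMap_cons, wordMap_cons, dist_rotatedSelfMap, ih, wordProd_cons, mul_assoc]

/-- Every point lies in cells of all sizes, up to a factor of `4`. -/
theorem exists_wordMap_eq (x : rotatedTriangle hlam) {s : ℝ} (hs : 0 < s) (hs1 : s ≤ 1) :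
    ∃ w y, wordMap hlam w y = x ∧ wordProd (ratio lam) w ≤ s ∧
      s ≤ 4 * wordProd (ratio lam) w := by
  -- Peeling off a letter divides `s` by a ratio at most `1 / 2`, so `n` bounds the number of
  -- letters needed. The word stops at the first letter that brings the product below `s`; as ratios
  -- are at least `1 / 4`, this overshoots by a factor of at most `4`.
  obtain ⟨n, hn⟩ := exists_pow_lt_of_lt_one hs (one_half_lt_one (α := ℝ))
  induction n generalizing x s with
  | zero => exact absurd hn (by simpa using hs1)
  | succ n ih =>
    obtain ⟨i, y, rfl⟩ := exists_rotatedSelfMap_eq hlam x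
    have hr := ratio_pos lam i
    by_cases h : s ≤ ratio lam i
    · obtain ⟨w, z, rfl, h1, h2⟩ := ih y (div_pos hs hr) ((div_le_one hr).2 h) (by
        rw [lt_div_iff₀ hr]
        refine lt_of_le_of_lt ?_ hn
        rw [pow_succ]
        exact mul_le_mul_of_nonneg_left (ratio_le_half hlam i) (by positivity))
      refine ⟨i :: w, z, rfl, ?_, ?_⟩
      · rw [le_div_iff₀ hr] at h1
        rw [wordProd_cons]; linarith
      · rw [div_le_iff₀ hr] at h2
        rw [wordProd_cons]; linarith
    · refine ⟨[i], y, rfl, ?_, ?_⟩ <;> simp only [wordProd_cons, wordProd_nil, mul_one]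
      · exact (not_le.1 h).le
      · linarith [quarter_le_ratio lam i]

/-- Corner maps at most halve a coordinate, just as they halve the cell, and each rotated map raises
all coordinates to at least `gap lam` again. -/
theorem gap_mul_le_coord_wordMap_three (w : List (Fin 4)) (k : Fin 3) (x : rotatedTriangle hlam) :
    gap lam * wordProd (ratio lam) w ≤
      coord hlam k (wordMap hlam w (rotatedSelfMap hlam 3 x)) := by
  induction w with
  | nil => simpa using gap_le_coord_three k x
  | cons i w ih =>
    obtain rfl | ⟨j, rfl⟩ := eq_three_or_castSucc i
    · refine le_trans ?_ (gap_le_coord_three k _)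
      exact mul_le_of_le_one_right (gap_pos hlam).le (wordProd_ratio_le_one hlam _)
    · rw [wordMap_cons, wordProd_cons, ratio_castSucc]
      exact le_trans (by linarith) (half_coord_le j k _)

/-- Cells that involve the rotated map stay away from the sides of the triangle. -/
theorem gap_mul_le_coord_wordMap {w : List (Fin 4)} (hw : 3 ∈ w) (k : Fin 3)
    (x : rotatedTriangle hlam) :
    gap lam * wordProd (ratio lam) w ≤ coord hlam k (wordMap hlam w x) := by
  obtain ⟨u, v, rfl⟩ := List.append_of_mem hw
  rw [wordMap_append, wordMap_cons]
  refine le_trans ?_ (gap_mul_le_coord_wordMap_three u k _)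
  rw [wordProd_append]
  exact mul_le_mul_of_nonneg_left (mul_le_of_le_one_right (wordProd_ratio_pos lam u).le
    (wordProd_ratio_le_one hlam _)) (gap_pos hlam).le

/-! ### Estimates for self-similar measures -/

variable {p : Fin 4 → ℝ} {μ : Measure (rotatedTriangle hlam)}

theorem measureReal_eq_sum (hp : ∀ i, 0 < p i)
    (hμ : IsSelfSimilarMeasure (rotatedSelfMap hlam) p μ) {A : Set (rotatedTriangle hlam)}
    (hA : MeasurableSet A) : μ.real A = ∑ i, p i * μ.real (rotatedSelfMap hlam i ⁻¹' A) := by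
  have := hμ.1
  have h : μ A = ∑ i, ENNReal.ofReal (p i) * μ (rotatedSelfMap hlam i ⁻¹' A) := by
    conv_lhs => rw [hμ.2]
    simp only [Measure.coe_finsetSum, Finset.sum_apply, Measure.smul_apply, smul_eq_mul]
    exact Finset.sum_congr rfl fun i _ => by
      rw [Measure.map_apply (continuous_rotatedSelfMap i).measurable hA]
  rw [Measure.real, h, ENNReal.toReal_sum fun i _ =>
    ENNReal.mul_ne_top ENNReal.ofReal_ne_top (measure_ne_top μ _)]
  exact Finset.sum_congr rfl fun i _ => by
    rw [ENNReal.toReal_mul, ENNReal.toReal_ofReal (hp i).le, Measure.real]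

theorem measureReal_eq_mul (hp : ∀ i, 0 < p i)
    (hμ : IsSelfSimilarMeasure (rotatedSelfMap hlam) p μ) {A : Set (rotatedTriangle hlam)}
    (hA : MeasurableSet A) (i : Fin 4) (h : ∀ j, j ≠ i → rotatedSelfMap hlam j ⁻¹' A = ∅) :
    μ.real A = p i * μ.real (rotatedSelfMap hlam i ⁻¹' A) := by
  rw [measureReal_eq_sum hp hμ hA]
  refine Finset.sum_eq_single i (fun j _ hj => ?_) (fun h => absurd (Finset.mem_univ i) h)
  rw [h j hj, measureReal_empty, mul_zero]

theorem wordProd_le_measureReal (hp : ∀ i, 0 < p i)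
    (hμ : IsSelfSimilarMeasure (rotatedSelfMap hlam) p μ) (w : List (Fin 4))
    {A : Set (rotatedTriangle hlam)} (hA : MeasurableSet A) (h : ∀ x, wordMap hlam w x ∈ A) :
    wordProd p w ≤ μ.real A := by
  have := hμ.1
  induction w generalizing A with
  | nil =>
    rw [eq_univ_of_forall h]
    simp
  | cons i w ih =>
    rw [measureReal_eq_sum hp hμ hA, wordProd_cons]
    refine le_trans ?_ (Finset.single_le_sum (f := fun i => p i *
      μ.real (rotatedSelfMap hlam i ⁻¹' A)) (fun j _ => mul_nonneg (hp j).le measureReal_nonneg)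
      (Finset.mem_univ i))
    exact mul_le_mul_of_nonneg_left (ih ((continuous_rotatedSelfMap i).measurable hA) h) (hp i).le

theorem preimage_ball_rotatedSelfMap (i : Fin 4) (y : rotatedTriangle hlam) (s : ℝ) :
    rotatedSelfMap hlam i ⁻¹' Metric.ball (rotatedSelfMap hlam i y) (ratio lam i * s) =
      Metric.ball y s := by
  ext z
  rw [mem_preimage, Metric.mem_ball, Metric.mem_ball, dist_rotatedSelfMap,
    mul_lt_mul_iff_right₀ (ratio_pos lam i)]

/-- Other cells have `k`-th coordinate at most `1 / 2`, so only the `k`-th cell meets the corner,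
and its preimage is the corner of the previous level. -/
theorem measureReal_corner_le (hp : ∀ i, 0 < p i)
    (hμ : IsSelfSimilarMeasure (rotatedSelfMap hlam) p μ) (k : Fin 3) (n : ℕ) :
    μ.real {x | 1 - (1 / 2) ^ n < coord hlam k x} ≤ p k.castSucc ^ n := by
  have := hμ.1
  induction n with
  | zero => simp
  | succ n ih =>
    have hn : (1 / 2 : ℝ) ^ n ≤ 1 := pow_le_one₀ (by norm_num) (by norm_num)
    rw [measureReal_eq_mul hp hμ (isOpen_lt continuous_const
      (continuous_coord hlam k)).measurableSet k.castSucc, pow_succ' (p _)]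
    · refine mul_le_mul_of_nonneg_left ((measureReal_mono fun x hx => ?_).trans ih) (hp _).le
      rw [mem_preimage, mem_ofPred_eq, coord_castSucc_self, pow_succ] at hx
      rw [mem_ofPred_eq]
      linarith
    · refine fun j hj => eq_empty_of_forall_notMem fun x hx => ?_
      rw [mem_preimage, mem_ofPred_eq, pow_succ] at hx
      linarith [coord_le_half hj x]

theorem sum_fin_three_cyclic (f : Fin 3 → ℝ) (k : Fin 3) :
    ∑ i, f i = f k + f (k + 1) + f (k + 2) := by
  rw [Fin.sum_univ_three]
  fin_cases k
  · rfl
  · change _ = f 1 + f 2 + f 0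
    ring
  · change _ = f 2 + f 0 + f 1
    ring

variable (hlam) in
/-- A small set near the side opposite to the `k`-th vertex. -/
def sideSet (k : Fin 3) (a s : ℝ) : Set (rotatedTriangle hlam) :=
  {x | coord hlam k x < s ∧ |coord hlam (k + 1) x - a| < s}

theorem isOpen_sideSet (k : Fin 3) (a s : ℝ) : IsOpen (sideSet hlam k a s) :=
  (isOpen_lt (continuous_coord hlam k) continuous_const).inter
    (isOpen_lt ((continuous_coord hlam (k + 1)).sub continuous_const).abs continuous_const)

/-- Near a side only two corner cells matter. If the set meets just one, it scales to a similar set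
of the previous level. If it may meet both, it lies near the midpoint of the side and both preimages
lie in corners, each of mass at most `q ^ n`. The factor `2` therefore does not grow with `n`. -/
theorem measureReal_sideSet_le (hp : ∀ i, 0 < p i)
    (hμ : IsSelfSimilarMeasure (rotatedSelfMap hlam) p μ) {q : ℝ}
    (hq : ∀ i : Fin 3, p i.castSucc = q) (k : Fin 3) (n : ℕ) (a : ℝ) :
    μ.real (sideSet hlam k a (gap lam * (1 / 2) ^ n)) ≤ 2 * q ^ n := by
  have := hμ.1
  induction n generalizing a with
  | zero =>
    rw [pow_zero (M := ℝ) q]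
    linarith [measureReal_le_one (μ := μ) (s := sideSet hlam k a (gap lam * (1 / 2) ^ 0))]
  | succ n ih =>
    have hk1 : k + 1 ≠ k := by clear ih; revert k; decide
    have hk2 : k + 2 ≠ k := by clear ih; revert k; decide
    have hk12 : k + 1 ≠ k + 2 := by clear ih; revert k; decide
    have hg := gap_pos hlam
    have hg4 := gap_le_quarter lam
    have hn0 : 0 < (1 / 2 : ℝ) ^ n := by positivity
    have hn : (1 / 2 : ℝ) ^ n ≤ 1 := pow_le_one₀ (by norm_num) (by norm_num)
    have hq0 : 0 < q := hq 0 ▸ hp _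
    have hqn : 0 < q ^ n := pow_pos hq0 n
    have hgn : gap lam * (1 / 2 : ℝ) ^ n ≤ gap lam := mul_le_of_le_one_right hg.le hn
    have hgn' : gap lam * (1 / 2 : ℝ) ^ n ≤ 1 / 4 * (1 / 2) ^ n :=
      mul_le_mul_of_nonneg_right hg4 hn0.le
    have hgn0 : 0 < gap lam * (1 / 2 : ℝ) ^ n := mul_pos hg hn0
    have hs : gap lam * (1 / 2 : ℝ) ^ (n + 1) = gap lam * (1 / 2) ^ n / 2 := by ring
    rw [hs]
    set s := gap lam * (1 / 2 : ℝ) ^ n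
    set A := sideSet hlam k a (s / 2)
    have h3 : rotatedSelfMap hlam 3 ⁻¹' A = ∅ := eq_empty_of_forall_notMem fun x hx => by
      have h1 : coord hlam k _ < s / 2 := hx.1
      linarith [gap_le_coord_three k x]
    have hk : rotatedSelfMap hlam k.castSucc ⁻¹' A = ∅ := eq_empty_of_forall_notMem fun x hx => by
      have h1 : coord hlam k _ < s / 2 := hx.1
      rw [coord_castSucc_self] at h1
      linarith [coord_nonneg k x]
    have h1 (x) (hx : x ∈ rotatedSelfMap hlam (k + 1).castSucc ⁻¹' A) :
        x ∈ sideSet hlam k (2 * a - 1) s := by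
      obtain ⟨h1, h2⟩ : coord hlam k _ < s / 2 ∧ |coord hlam (k + 1) _ - a| < s / 2 := hx
      rw [coord_castSucc_ne hk1.symm] at h1
      rw [coord_castSucc_self, abs_lt] at h2
      exact ⟨by linarith, abs_lt.2 ⟨by linarith, by linarith⟩⟩
    have h2 (x) (hx : x ∈ rotatedSelfMap hlam (k + 2).castSucc ⁻¹' A) :
        x ∈ sideSet hlam k (2 * a) s := by
      obtain ⟨h1, h2⟩ : coord hlam k _ < s / 2 ∧ |coord hlam (k + 1) _ - a| < s / 2 := hx
      rw [coord_castSucc_ne hk2.symm] at h1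
      rw [coord_castSucc_ne hk12, abs_lt] at h2
      exact ⟨by linarith, abs_lt.2 ⟨by linarith, by linarith⟩⟩
    have hsum : μ.real A = q * μ.real (rotatedSelfMap hlam (k + 1).castSucc ⁻¹' A) +
        q * μ.real (rotatedSelfMap hlam (k + 2).castSucc ⁻¹' A) := by
      rw [measureReal_eq_sum hp hμ (isOpen_sideSet k a _).measurableSet, Fin.sum_univ_castSucc,
        sum_fin_three_cyclic _ k]
      change _ + p 3 * μ.real (rotatedSelfMap hlam 3 ⁻¹' A) = _
      rw [h3, hk, hq (k + 1), hq (k + 2), measureReal_empty, mul_zero, mul_zero, zero_add, add_zero]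
    suffices h : μ.real (rotatedSelfMap hlam (k + 1).castSucc ⁻¹' A) +
        μ.real (rotatedSelfMap hlam (k + 2).castSucc ⁻¹' A) ≤ 2 * q ^ n by
      rw [hsum, pow_succ]
      nlinarith
    rcases le_or_gt (2 * a - 1 + s) 0 with ha | ha
    · have : rotatedSelfMap hlam (k + 1).castSucc ⁻¹' A = ∅ :=
        eq_empty_of_forall_notMem fun x hx => by
          linarith [(abs_lt.1 (h1 x hx).2).2, coord_nonneg (k + 1) x]
      rw [this, measureReal_empty, zero_add]
      exact (measureReal_mono h2).trans (ih _)
    rcases le_or_gt (1 + s) (2 * a) with ha' | ha'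
    · have : rotatedSelfMap hlam (k + 2).castSucc ⁻¹' A = ∅ :=
        eq_empty_of_forall_notMem fun x hx => by
          linarith [(abs_lt.1 (h2 x hx).2).1, coord_le_one (k + 1) x]
      rw [this, measureReal_empty, add_zero]
      exact (measureReal_mono h1).trans (ih _)
    -- Here `|2 * a - 1| < s`, so the two other coordinates add up to less than `3 * s`, which is
    -- below `(1 / 2) ^ n` because `gap lam ≤ 1 / 4`.
    have hc1 : μ.real (rotatedSelfMap hlam (k + 1).castSucc ⁻¹' A) ≤ q ^ n := by
      rw [← hq (k + 2)]
      refine (measureReal_mono fun x hx => ?_).trans (measureReal_corner_le hp hμ (k + 2) n)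
      have h4 := h1 x hx
      rw [mem_ofPred_eq]
      linarith [(abs_lt.1 h4.2).2, h4.1, sum_coord k x]
    have hc2 : μ.real (rotatedSelfMap hlam (k + 2).castSucc ⁻¹' A) ≤ q ^ n := by
      rw [← hq (k + 1)]
      refine (measureReal_mono fun x hx => ?_).trans (measureReal_corner_le hp hμ (k + 1) n)
      have h4 := h2 x hx
      rw [mem_ofPred_eq]
      linarith [(abs_lt.1 h4.2).1]
    linarith

/-- If a ball around a point of a cell meets no other cell, its measure is that of a ball around
the preimage of the point, scaled by the weight of the cell. -/
theorem measureReal_ball_eq_mul (hp : ∀ i, 0 < p i)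
    (hμ : IsSelfSimilarMeasure (rotatedSelfMap hlam) p μ) {i : Fin 4} {y : rotatedTriangle hlam}
    {s : ℝ} (h : ∀ j, j ≠ i → ∀ z,
      ratio lam i * s ≤ dist (rotatedSelfMap hlam i y) (rotatedSelfMap hlam j z)) :
    μ.real (Metric.ball (rotatedSelfMap hlam i y) (ratio lam i * s)) =
      p i * μ.real (Metric.ball y s) := by
  rw [measureReal_eq_mul hp hμ Metric.isOpen_ball.measurableSet i, preimage_ball_rotatedSelfMap]
  refine fun j hj => eq_empty_of_forall_notMem fun z hz => ?_
  rw [mem_preimage, Metric.mem_ball, dist_comm] at hz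
  exact absurd hz (h j hj z).not_gt

/-- A final rotated letter keeps the centre away from the sides at every level, so the ball never
meets a second cell. This needs no relation between the weights, which is what the necessity part
requires. -/
theorem measureReal_ball_wordMap_three_le (hp : ∀ i, 0 < p i)
    (hμ : IsSelfSimilarMeasure (rotatedSelfMap hlam) p μ) (w : List (Fin 4))
    (x : rotatedTriangle hlam) :
    μ.real (Metric.ball (wordMap hlam w (rotatedSelfMap hlam 3 x))
      (gap lam ^ 2 / 4 * wordProd (ratio lam) w)) ≤ wordProd p w := by
  have := hμ.1
  induction w with
  | nil => simp
  | cons i w ih =>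
    rw [wordMap_cons, wordProd_cons, wordProd_cons, mul_left_comm, measureReal_ball_eq_mul hp hμ]
    · exact mul_le_mul_of_nonneg_left ih (hp i).le
    · intro j hj z
      obtain ⟨k, hk⟩ := exists_gap_mul_coord_le hj.symm
        (wordMap hlam w (rotatedSelfMap hlam 3 x)) z
      have h1 := mul_le_mul_of_nonneg_left (gap_mul_le_coord_wordMap_three w k x)
        (gap_pos hlam).le
      have h2 := mul_le_mul_of_nonneg_right (ratio_le_half hlam i) (mul_nonneg (div_nonneg
        (sq_nonneg (gap lam)) (by norm_num : (0 : ℝ) ≤ 4)) (wordProd_ratio_pos lam w).le)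
      have h3 := mul_pos (pow_pos (gap_pos hlam) 2) (wordProd_ratio_pos lam w)
      nlinarith

theorem measureReal_ball_near_side_le (hp : ∀ i, 0 < p i)
    (hμ : IsSelfSimilarMeasure (rotatedSelfMap hlam) p μ) {q : ℝ}
    (hq : ∀ i : Fin 3, p i.castSucc = q) {n : ℕ} {e : ℝ}
    (he : e ≤ gap lam ^ 2 / 8 * (1 / 2) ^ n) {k : Fin 3} {z : rotatedTriangle hlam}
    (hz : gap lam * coord hlam k z ≤ 2 * e) : μ.real (Metric.ball z (8 * e)) ≤ 2 * q ^ n := by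
  have := hμ.1
  refine (measureReal_mono fun x hx => ?_).trans
    (measureReal_sideSet_le hp hμ hq k n (coord hlam (k + 1) z))
  rw [Metric.mem_ball] at hx
  have hg := gap_pos hlam
  have hn0 : 0 < (1 / 2 : ℝ) ^ n := by positivity
  have h1 : coord hlam k z ≤ gap lam / 4 * (1 / 2) ^ n := by
    refine le_of_mul_le_mul_left (hz.trans ?_) hg
    linarith
  have h2 : 16 * e ≤ gap lam / 2 * (1 / 2) ^ n := by
    have := mul_le_mul_of_nonneg_right (mul_le_mul_of_nonneg_left (gap_le_quarter lam) hg.le)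
      hn0.le
    nlinarith
  have h3 : 0 < gap lam * (1 / 2) ^ n := mul_pos hg hn0
  have h4 := abs_le.1 (abs_coord_sub_le k x z)
  refine ⟨by linarith, ?_⟩
  linarith [abs_coord_sub_le (k + 1) x z]

/-- Balls of the size of a cell around its points are not much heavier than the cell, provided the
weights of the three corner cells agree. -/
theorem measureReal_ball_wordMap_le (hp : ∀ i, 0 < p i) (hsum : ∑ i, p i = 1)
    (hμ : IsSelfSimilarMeasure (rotatedSelfMap hlam) p μ) {q m : ℝ}
    (hq : ∀ i : Fin 3, p i.castSucc = q) (hm : 0 < m) (hmp : ∀ i, m ≤ p i) (w : List (Fin 4))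
    (x : rotatedTriangle hlam) :
    μ.real (Metric.ball (wordMap hlam w x) (gap lam ^ 2 / 4 * wordProd (ratio lam) w)) ≤
      2 / m * wordProd p w := by
  have := hμ.1
  have hq0 : 0 < q := hq 0 ▸ hp _
  induction w with
  | nil =>
    refine measureReal_le_one.trans ?_
    have : m ≤ 1 := (hmp 0).trans (hsum ▸ Finset.single_le_sum (f := p)
      (fun i _ => (hp i).le) (Finset.mem_univ 0))
    rw [wordProd_nil, mul_one, le_div_iff₀ hm]
    linarith
  | cons i w ih =>
    rw [wordMap_cons, wordProd_cons, wordProd_cons, mul_left_comm]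
    set y := wordMap hlam w x with hy
    set s := gap lam ^ 2 / 4 * wordProd (ratio lam) w with hs
    by_cases h : ∀ j, j ≠ i → ∀ z,
      ratio lam i * s ≤ dist (rotatedSelfMap hlam i y) (rotatedSelfMap hlam j z)
    · rw [measureReal_ball_eq_mul hp hμ h]
      linarith [mul_le_mul_of_nonneg_left ih (hp i).le]
    push Not at h
    obtain ⟨j, hj, z, hz⟩ := h
    obtain ⟨k, hk⟩ := exists_gap_mul_coord_le hj.symm y z
    have hg := gap_pos hlam
    have hs0 : 0 < s := mul_pos (by positivity) (wordProd_ratio_pos lam w)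
    have he : ratio lam i * s ≤ s / 2 := by
      linarith [mul_le_mul_of_nonneg_right (ratio_le_half hlam i) hs0.le]
    -- A rotated letter would give `gap lam * coord hlam k y ≥ gap lam ^ 2 * r_w`, whereas this
    -- quantity is below `2 * ratio lam i * s ≤ s = gap lam ^ 2 / 4 * r_w`.
    have hw : 3 ∉ w := fun hw => by
      have h1 := mul_le_mul_of_nonneg_left (gap_mul_le_coord_wordMap hw k x) hg.le
      have h2 := mul_pos (pow_pos hg 2) (wordProd_ratio_pos lam w)
      rw [← hy] at h1
      nlinarith
    have hsn : s = gap lam ^ 2 / 4 * (1 / 2) ^ w.length := by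
      rw [hs, wordProd_eq_pow (ratio_castSucc lam) hw]
    set e := ratio lam i * s
    have hen : e ≤ gap lam ^ 2 / 8 * (1 / 2) ^ w.length := by linarith
    have hterm (l : Fin 4) : μ.real (rotatedSelfMap hlam l ⁻¹'
        Metric.ball (rotatedSelfMap hlam i y) e) ≤ 2 * q ^ w.length := by
      obtain hl | ⟨z', hz'⟩ := (rotatedSelfMap hlam l ⁻¹'
        Metric.ball (rotatedSelfMap hlam i y) e).eq_empty_or_nonempty
      · rw [hl, measureReal_empty]; positivity
      -- Each nonempty preimage contains a point `z₀` near a side. Two points of the preimage have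
      -- images less than `2 * e` apart and the ratio is at least `1 / 4`, so the preimage lies in
      -- the ball of radius `8 * e` about `z₀`.
      obtain ⟨z₀, hz₀, k', hk'⟩ : ∃ z₀, dist (rotatedSelfMap hlam l z₀)
          (rotatedSelfMap hlam i y) < e ∧ ∃ k', gap lam * coord hlam k' z₀ ≤ 2 * e := by
        by_cases hli : l = i
        · subst hli
          exact ⟨y, by rw [dist_self]; exact mul_pos (ratio_pos lam l) hs0, k, by linarith⟩
        · obtain ⟨k', hk'⟩ := exists_gap_mul_coord_le hli z' y
          rw [mem_preimage, Metric.mem_ball] at hz'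
          exact ⟨z', hz', k', by linarith⟩
      refine (measureReal_mono fun z hz => ?_).trans
        (measureReal_ball_near_side_le hp hμ hq hen hk')
      rw [mem_preimage, Metric.mem_ball] at hz
      have h1 := dist_triangle_right (rotatedSelfMap hlam l z) (rotatedSelfMap hlam l z₀)
        (rotatedSelfMap hlam i y)
      rw [dist_rotatedSelfMap] at h1
      have h2 := mul_le_mul_of_nonneg_right (quarter_le_ratio lam l) (dist_nonneg (x := z) (y := z₀))
      rw [Metric.mem_ball]
      linarith
    calc μ.real (Metric.ball (rotatedSelfMap hlam i y) e)
        = ∑ l, p l * μ.real (rotatedSelfMap hlam l ⁻¹'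
            Metric.ball (rotatedSelfMap hlam i y) e) :=
          measureReal_eq_sum hp hμ Metric.isOpen_ball.measurableSet
      _ ≤ ∑ l, p l * (2 * q ^ w.length) :=
          Finset.sum_le_sum fun l _ => mul_le_mul_of_nonneg_left (hterm l) (hp l).le
      _ = 2 * q ^ w.length := by rw [← Finset.sum_mul, hsum, one_mul]
      -- The factor `1 / m` pays for the weight of the first letter, which may be the rotated one.
      -- The bound is direct, without the induction hypothesis, so the constant does not accumulate.
      _ ≤ 2 / m * (p i * wordProd p w) := by
          rw [wordProd_eq_pow hq hw, div_mul_eq_mul_div, le_div_iff₀ hm]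
          have := mul_le_mul_of_nonneg_right (hmp i) (pow_pos hq0 w.length).le
          linarith

end RotatedTriangle

namespace RotatedTriangle

/-! ### Sufficiency: both doubling properties for equal corner weights -/

variable {lam : ℝ} {hlam : lam ∈ Ioo (0 : ℝ) (1 / 2)}
  {p : Fin 4 → ℝ} {μ : Measure (rotatedTriangle hlam)}

theorem ofReal_mul_measure_le_iff {M : Type*} [MeasurableSpace M] {ν : Measure M}
    [IsFiniteMeasure ν] {C : ℝ} (hC : 0 ≤ C) {A B : Set M} :
    ENNReal.ofReal C * ν A ≤ ν B ↔ C * ν.real A ≤ ν.real B := by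
  rw [← ofReal_measureReal (s := A), ← ofReal_measureReal (s := B), ← ENNReal.ofReal_mul hC,
    ENNReal.ofReal_le_ofReal_iff measureReal_nonneg]

theorem measure_le_ofReal_mul_iff {M : Type*} [MeasurableSpace M] {ν : Measure M}
    [IsFiniteMeasure ν] {C : ℝ} (hC : 0 ≤ C) {A B : Set M} :
    ν A ≤ ENNReal.ofReal C * ν B ↔ ν.real A ≤ C * ν.real B := by
  rw [← ofReal_measureReal (s := A), ← ofReal_measureReal (s := B), ← ENNReal.ofReal_mul hC,
    ENNReal.ofReal_le_ofReal_iff (mul_nonneg hC measureReal_nonneg)]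

/-- Cells are contained in balls of comparable size. -/
theorem wordProd_le_measureReal_ball (hp : ∀ i, 0 < p i)
    (hμ : IsSelfSimilarMeasure (rotatedSelfMap hlam) p μ) (w : List (Fin 4))
    (x : rotatedTriangle hlam) {r : ℝ} (hr : 4 * wordProd (ratio lam) w < r) :
    wordProd p w ≤ μ.real (Metric.ball (wordMap hlam w x) r) := by
  refine wordProd_le_measureReal hp hμ w Metric.isOpen_ball.measurableSet fun y => ?_
  rw [Metric.mem_ball, dist_wordMap]
  have := mul_le_mul_of_nonneg_left (dist_le_four y x) (wordProd_ratio_pos lam w).le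
  linarith

theorem exists_pos_le_weights (hp : ∀ i, 0 < p i) : ∃ m, 0 < m ∧ ∀ i, m ≤ p i := by
  obtain ⟨i, hi⟩ := Finite.exists_min p
  exact ⟨p i, hp i, hi⟩

theorem weight_lt_one (hp : ∀ i, 0 < p i) (hsum : ∑ i, p i = 1) (i : Fin 4) : p i < 1 := by
  have hne : ∀ i : Fin 4, ∃ j, j ≠ i := by decide
  obtain ⟨j, hj⟩ := hne i
  rw [← hsum]
  exact Finset.single_lt_sum hj (Finset.mem_univ i) (Finset.mem_univ j) (hp j)
    fun k _ _ => (hp k).le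

theorem exists_ratio_pow_le_weight (hlam : lam ∈ Ioo (0 : ℝ) (1 / 2)) (hp : ∀ i, 0 < p i) :
    ∃ n : ℕ, ∀ i, ratio lam i ^ n ≤ p i := by
  obtain ⟨m, hm, hmp⟩ := exists_pos_le_weights hp
  obtain ⟨n, hn⟩ := exists_pow_lt_of_lt_one hm (one_half_lt_one (α := ℝ))
  exact ⟨n, fun i => (pow_le_pow_left₀ (ratio_pos lam i).le (ratio_le_half hlam i) n).trans
    (hn.le.trans (hmp i))⟩

/-- All weights are below `1` and all ratios at least `1 / 4`, while `(1 / 4) ^ t` tends to `1` as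
`t` decreases to `0`; so a small `t` works. -/
theorem exists_weight_le_ratio_rpow (hp : ∀ i, 0 < p i) (hsum : ∑ i, p i = 1) :
    ∃ t : ℝ, 0 < t ∧ ∀ i, p i ≤ ratio lam i ^ t := by
  obtain ⟨i₀, hi₀⟩ := Finite.exists_max p
  have hcont : Filter.Tendsto (fun t : ℝ => (1 / 4 : ℝ) ^ t) (nhdsWithin 0 (Ioi 0)) (nhds 1) := by
    have h : ContinuousAt (fun t : ℝ => (1 / 4 : ℝ) ^ t) 0 :=
      Real.continuousAt_const_rpow (by norm_num)
    have h' := h.tendsto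
    rw [Real.rpow_zero] at h'
    exact h'.mono_left nhdsWithin_le_nhds
  obtain ⟨t, ht, ht0⟩ := ((hcont.eventually (lt_mem_nhds (weight_lt_one hp hsum i₀))).and
    self_mem_nhdsWithin).exists
  exact ⟨t, ht0, fun i => (hi₀ i).trans (ht.le.trans
    (Real.rpow_le_rpow (by norm_num) (quarter_le_ratio lam i) (le_of_lt ht0)))⟩

theorem volumeDoubling_of_eq (hp : ∀ i, 0 < p i) (hsum : ∑ i, p i = 1)
    (hμ : IsSelfSimilarMeasure (rotatedSelfMap hlam) p μ) {q : ℝ}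
    (hq : ∀ i : Fin 3, p i.castSucc = q) : VolumeDoubling μ := by
  have := hμ.1
  obtain ⟨m, hm, hmp⟩ := exists_pos_le_weights hp
  obtain ⟨N, hN⟩ := exists_ratio_pow_le_weight hlam hp
  have hm1 : m ≤ 1 := (hmp 0).trans (weight_lt_one hp hsum 0).le
  have hg := gap_pos hlam
  have hg4 := gap_le_quarter lam
  set c := gap lam ^ 2 / 4 with hc
  have hc0 : 0 < c := by positivity
  have hc1 : c ≤ 1 := by nlinarith
  -- Chosen so that `8 * r / c * s₀ = r / 8`: a subcell of that relative size has diameter at most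
  -- `r / 2` and fits into the small ball.
  set s₀ := c / 16 / 4 with hs₀
  have hs₀0 : 0 < s₀ := by positivity
  have hs₀1 : s₀ ≤ 1 := by rw [hs₀]; linarith
  have hpos : 0 < (s₀ / 4) ^ N := by positivity
  have hC : 1 ≤ 2 / m / (s₀ / 4) ^ N := by
    rw [one_le_div hpos]
    refine (pow_le_one₀ (by positivity) (by linarith)).trans ?_
    rw [one_le_div hm]
    linarith
  refine ⟨2 / m / (s₀ / 4) ^ N, hC, fun x r hr => ?_⟩
  rw [measure_le_ofReal_mul_iff (zero_le_one.trans hC)]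
  -- A word with `r_w` between `2 * r / c` and `8 * r / c` makes the ball of radius `2 * r` small
  -- enough for the upper bound. If `8 * r / c > 1`, the empty word and total mass `1` suffice.
  obtain ⟨w, x', rfl, h1, h2⟩ : ∃ w x', wordMap hlam w x' = x ∧
      wordProd (ratio lam) w ≤ 8 * r / c ∧
      μ.real (Metric.ball x (2 * r)) ≤ 2 / m * wordProd p w := by
    rcases le_or_gt (8 * r / c) 1 with h | h
    · obtain ⟨w, x', rfl, h1, h2⟩ := exists_wordMap_eq x (div_pos (by linarith) hc0) h
      refine ⟨w, x', rfl, h1, (measureReal_mono (Metric.ball_subset_ball ?_)).trans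
        (measureReal_ball_wordMap_le hp hsum hμ hq hm hmp w x')⟩
      rw [div_le_iff₀ hc0] at h2
      rw [← hc]
      linarith
    · refine ⟨[], x, rfl, by simpa using h.le, measureReal_le_one.trans ?_⟩
      rw [wordProd_nil, mul_one, one_le_div hm]
      linarith
  obtain ⟨u, y, rfl, h3, h4⟩ := exists_wordMap_eq x' hs₀0 hs₀1
  have hw0 := wordProd_ratio_pos lam w
  have hlow : wordProd p w * wordProd p u ≤
      μ.real (Metric.ball (wordMap hlam w (wordMap hlam u y)) r) := by
    rw [← wordProd_append, ← wordMap_append]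
    refine wordProd_le_measureReal_ball hp hμ _ _ ?_
    rw [wordProd_append]
    have h5 := mul_le_mul h1 h3 (wordProd_ratio_pos lam u).le (by positivity)
    have h6 : 8 * r / c * s₀ = r / 8 := by rw [hs₀]; field_simp; norm_num
    linarith
  refine h2.trans ?_
  have h5 : (s₀ / 4) ^ N ≤ wordProd p u :=
    (pow_le_pow_left₀ (by positivity) (by linarith) N).trans
      (le_wordProd_pow hp (ratio_pos lam) hN u)
  have h6 := mul_le_mul_of_nonneg_left h5 (wordProd_pos hp w).le
  rw [div_mul_eq_mul_div (2 / m), le_div_iff₀ hpos, mul_assoc]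
  exact mul_le_mul_of_nonneg_left (h6.trans hlow) (by positivity)

theorem reverseVolumeDoubling_of_eq (hp : ∀ i, 0 < p i) (hsum : ∑ i, p i = 1)
    (hμ : IsSelfSimilarMeasure (rotatedSelfMap hlam) p μ) {q : ℝ}
    (hq : ∀ i : Fin 3, p i.castSucc = q) : ReverseVolumeDoubling μ := by
  have := hμ.1
  obtain ⟨m, hm, hmp⟩ := exists_pos_le_weights hp
  obtain ⟨t, ht0, ht⟩ := exists_weight_le_ratio_rpow (lam := lam) hp hsum
  have hm1 : m ≤ 1 := (hmp 0).trans (weight_lt_one hp hsum 0).le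
  have hg := gap_pos hlam
  set c := gap lam ^ 2 / 4 with hc
  have hc0 : 0 < c := by positivity
  set D := 128 / c with hD
  have hD0 : 0 < D := by positivity
  have h2m : 1 ≤ 2 / m := by rw [one_le_div hm]; linarith
  refine ⟨2 / m * D ^ t, t, by positivity, ht0, fun x r R hr hrR hR => ?_⟩
  have hR0 : 0 < R := hr.trans_le hrR
  have hR4 : R ≤ 4 := by
    have h : Metric.ediam (univ : Set (rotatedTriangle hlam)) ≤ ENNReal.ofReal 4 :=
      Metric.ediam_le fun x _ y _ => by
        rw [edist_dist]
        exact ENNReal.ofReal_le_ofReal (dist_le_four x y)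
    exact (ENNReal.ofReal_le_ofReal_iff (by norm_num)).1 (hR.le.trans h)
  have hRr : 0 < R / r := div_pos hR0 hr
  rw [ofReal_mul_measure_le_iff (by positivity), mul_assoc, inv_mul_le_iff₀ (by positivity)]
  obtain ⟨w, x', rfl, h1, h2⟩ := exists_wordMap_eq x (s := R / 8) (by linarith) (by linarith)
  have hw0 := wordProd_ratio_pos lam w
  -- The relative size of a subcell for which `c * r_w * r_u ≥ r`. Since `R ≤ 32 * r_w`, the product
  -- `s * (R / r)` is at most `D = 128 / c`; in particular `s > 1` forces `R / r < D`, and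
  -- monotonicity of the measure is then enough.
  set s := 4 * r / (c * wordProd (ratio lam) w) with hs
  have hs0 : 0 < s := by positivity
  have hsR : s * (R / r) ≤ D := by
    rw [hs, hD, div_mul_div_comm, div_le_div_iff₀ (by positivity) hc0]
    have := mul_le_mul_of_nonneg_left h2 (mul_pos hr hc0).le
    linarith
  rcases le_or_gt s 1 with h | h
  · obtain ⟨u, y, rfl, h3, h4⟩ := exists_wordMap_eq x' hs0 h
    have hup : μ.real (Metric.ball (wordMap hlam w (wordMap hlam u y)) r) ≤
        2 / m * (wordProd p w * wordProd p u) := by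
      rw [← wordProd_append, ← wordMap_append]
      refine (measureReal_mono (Metric.ball_subset_ball ?_)).trans
        (measureReal_ball_wordMap_le hp hsum hμ hq hm hmp _ y)
      rw [wordProd_append]
      rw [hs, div_le_iff₀ (by positivity)] at h4
      rw [← hc]
      linarith
    have hlow : wordProd p w ≤ μ.real (Metric.ball (wordMap hlam w (wordMap hlam u y)) R) :=
      wordProd_le_measureReal_ball hp hμ w _ (by linarith)
    have hu : wordProd p u ≤ s ^ t :=
      (wordProd_rpow_le hp (ratio_pos lam) ht u).trans
        (Real.rpow_le_rpow (wordProd_ratio_pos lam u).le h3 ht0.le)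
    have hst : (R / r) ^ t * s ^ t ≤ D ^ t := by
      rw [← Real.mul_rpow hRr.le hs0.le]
      exact Real.rpow_le_rpow (by positivity) (by linarith) ht0.le
    have hw := wordProd_pos hp w
    calc (R / r) ^ t * μ.real (Metric.ball (wordMap hlam w (wordMap hlam u y)) r)
        ≤ (R / r) ^ t * (2 / m * (wordProd p w * s ^ t)) := by gcongr; exact hup.trans (by gcongr)
      _ = 2 / m * ((R / r) ^ t * s ^ t) * wordProd p w := by ring
      _ ≤ _ := by gcongr
  · refine mul_le_mul ?_ (measureReal_mono (Metric.ball_subset_ball hrR)) measureReal_nonneg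
      (by positivity)
    refine (Real.rpow_le_rpow hRr.le (?_ : _ ≤ D) ht0.le).trans
      (le_mul_of_one_le_left (by positivity) h2m)
    nlinarith

/-! ### Necessity: adjacent cells at the midpoint of a side -/

/-- The cell of a power of a corner map, in coordinates. -/
theorem coord_wordMap_replicate (i k : Fin 3) (n : ℕ) (x : rotatedTriangle hlam) :
    coord hlam k (wordMap hlam (List.replicate n i.castSucc) x) =
      (1 / 2) ^ n * coord hlam k x + (1 - (1 / 2) ^ n) * if k = i then 1 else 0 := by
  induction n with
  | zero => simp
  | succ n ih =>
    rw [List.replicate_succ, wordMap_cons, coord_castSucc, ih]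
    ring

theorem dist_adjacent_corner_cells_le (i j : Fin 3) (n : ℕ)
    (x y : rotatedTriangle hlam) :
    dist (wordMap hlam (i.castSucc :: List.replicate n j.castSucc) x)
      (wordMap hlam (j.castSucc :: List.replicate n i.castSucc) y) ≤ 4 * (1 / 2) ^ n := by
  have hk (k : Fin 3) :
      |coord hlam k (wordMap hlam (i.castSucc :: List.replicate n j.castSucc) x) -
        coord hlam k (wordMap hlam (j.castSucc :: List.replicate n i.castSucc) y)| ≤
          (1 / 2) ^ n := by
    rw [wordMap_cons, wordMap_cons, coord_castSucc, coord_castSucc, coord_wordMap_replicate,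
      coord_wordMap_replicate]
    have hn : (0 : ℝ) < (1 / 2) ^ n := by positivity
    set e : ℝ := (1 / 2) ^ n
    have h1 := mul_nonneg hn.le (coord_nonneg k x)
    have h2 := mul_nonneg hn.le (coord_nonneg k y)
    have h3 := mul_le_of_le_one_right hn.le (coord_le_one k x)
    have h4 := mul_le_of_le_one_right hn.le (coord_le_one k y)
    rw [abs_le]
    split_ifs <;> constructor <;> linarith
  linarith [dist_le_abs_coord_sub (wordMap hlam (i.castSucc :: List.replicate n j.castSucc) x)
    (wordMap hlam (j.castSucc :: List.replicate n i.castSucc) y), hk 0, hk 2]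

theorem wordProd_cons_replicate (a : Fin 4 → ℝ) (i j : Fin 4) (n : ℕ) :
    wordProd a (i :: List.replicate n j) = a i * a j ^ n := by
  simp [wordProd]

theorem weight_le_of_volumeDoubling (hp : ∀ i, 0 < p i)
    (hμ : IsSelfSimilarMeasure (rotatedSelfMap hlam) p μ) (h : VolumeDoubling μ) (i j : Fin 3) :
    p i.castSucc ≤ p j.castSucc := by
  have := hμ.1
  obtain ⟨C, hC1, hC⟩ := h
  have hC0 : 0 < C := by linarith
  simp only [measure_le_ofReal_mul_iff hC0.le] at hC
  have hiter (N : ℕ) (x : rotatedTriangle hlam) (r : ℝ) (hr : 0 < r) :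
      μ.real (Metric.ball x (2 ^ N * r)) ≤ C ^ N * μ.real (Metric.ball x r) := by
    induction N with
    | zero => simp
    | succ N ih =>
      have h1 := hC x (2 ^ N * r) (by positivity)
      rw [pow_succ', pow_succ', mul_assoc, mul_assoc]
      exact h1.trans (mul_le_mul_of_nonneg_left ih hC0.le)
  by_contra! hlt
  set a := p i.castSucc
  set b := p j.castSucc
  have ha : 0 < a := hp _
  have hb : 0 < b := hp _
  have hg := gap_pos hlam
  -- The extra division by `2` is the ratio of the first letter of the word.
  set c := gap lam ^ 2 / 4 / 2 with hc
  have hc0 : 0 < c := by positivity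
  obtain ⟨N, hN⟩ := pow_unbounded_of_one_lt (8 / c) (one_lt_two (α := ℝ))
  rw [div_lt_iff₀ hc0] at hN
  obtain ⟨x⟩ : Nonempty (rotatedTriangle hlam) :=
    (isSelfSimilarSet_rotatedTriangle hlam).nonempty.to_subtype
  -- The ball of radius `c * (1 / 2) ^ n` about a point of the cell `i jⁿ 3` has mass at most `a * b
  -- ^ n`, while its enlargement by `2 ^ N` swallows the whole cell `j iⁿ`.
  have key (n : ℕ) : b * a ^ n ≤ C ^ N * (a * b ^ n) := by
    have hn : (0 : ℝ) < (1 / 2) ^ n := by positivity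
    have h1 := measureReal_ball_wordMap_three_le hp hμ
      (i.castSucc :: List.replicate n j.castSucc) x
    have hr : gap lam ^ 2 / 4 *
        wordProd (ratio lam) (i.castSucc :: List.replicate n j.castSucc) = c * (1 / 2) ^ n := by
      rw [wordProd_cons_replicate, ratio_castSucc, ratio_castSucc, hc]; ring
    rw [hr, wordProd_cons_replicate] at h1
    refine le_trans ?_ ((hiter N _ _ (mul_pos hc0 hn)).trans
      (mul_le_mul_of_nonneg_left h1 (by positivity)))
    rw [← wordProd_cons_replicate]
    refine wordProd_le_measureReal hp hμ _ Metric.isOpen_ball.measurableSet fun y => ?_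
    rw [Metric.mem_ball]
    refine (dist_adjacent_corner_cells_le j i n y _).trans_lt ?_
    have := mul_lt_mul_of_pos_right hN hn
    linarith
  obtain ⟨n, hn⟩ := pow_unbounded_of_one_lt (C ^ N * a / b) ((one_lt_div hb).2 hlt)
  rw [div_pow, div_lt_div_iff₀ hb (by positivity)] at hn
  linarith [key n]

end RotatedTriangle

open RotatedTriangle in
theorem corollary4p6 (lam : ℝ) (hlam : lam ∈ Set.Ioo (0 : ℝ) (1 / 2))
    (p : Fin 4 → ℝ) (hp : ∀ i, 0 < p i) (hsum : ∑ i, p i = 1)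
    (μ : MeasureTheory.Measure (RotatedTriangle.rotatedTriangle hlam))
    (hμ : RotatedTriangle.IsSelfSimilarMeasure (RotatedTriangle.rotatedSelfMap hlam) p μ) :
    (RotatedTriangle.VolumeDoubling μ ∧ RotatedTriangle.ReverseVolumeDoubling μ) ↔
      (p 0 = p 1 ∧ p 1 = p 2) := by
  constructor
  · rintro ⟨h, -⟩
    have hle := weight_le_of_volumeDoubling hp hμ h
    exact ⟨(hle 0 1).antisymm (hle 1 0), (hle 1 2).antisymm (hle 2 1)⟩
  · rintro ⟨h01, h12⟩
    have hq (i : Fin 3) : p i.castSucc = p 0 := by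
      fin_cases i
      · rfl
      · exact h01.symm
      · exact (h01.trans h12).symm
    exact ⟨volumeDoubling_of_eq hp hsum hμ hq, reverseVolumeDoubling_of_eq hp hsum hμ hq⟩
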